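/- For integers $n\ge 1$ and $k\ge 0$ with $2k\le n$, the bipartite Kneser graph $H(n,k)$ has as vertices all $k$-element and all $(n-k)$-element subsets of $\{1,\ldots,n\}$, and two distinct vertices are joined by an edge if and only if one of them is contained in the other. A Hamilton cycle of a graph is a cycle that visits every vertex exactly once; two Hamilton cycles are distinct if they are distinct as subgraphs, that is, if their edge sets differ. Theorem. For every integer $k\ge 1$, the bipartite Kneser graph $H(2k+1,k)$ has a Hamilton cycle. For every integer $k\ge 6$, the bipartite Kneser graph $H(2k+1,k)$ has at least $2^{2^{k-6}}$ distinct Hamilton cycles. -/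

import Mathlib

/-- The vertices of the bipartite Kneser graph `H(n, k)`: the subsets of an `n`-element set that
have exactly `k` or exactly `n - k` elements. -/
abbrev BipartiteKneserVertex (n k : ℕ) : Type :=
  {s : Finset (Fin n) // s.card = k ∨ s.card + k = n}

/-- The bipartite Kneser graph `H(n, k)`: two distinct vertices are adjacent if and only if one of
them is contained in the other. -/
def bipartiteKneserGraph (n k : ℕ) : SimpleGraph (BipartiteKneserVertex n k) where
  Adj s t := s.1 ⊂ t.1 ∨ t.1 ⊂ s.1
  symm := ⟨fun _ _ h => h.symm⟩
  loopless := ⟨fun _ h => h.elim (fun h => h.ne rfl) (fun h => h.ne rfl)⟩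

/-- The Hamilton cycles of `G` as subgraphs of `G`. Closed walks that differ only in their starting
vertex or their orientation give the same element of this set. -/
def hamiltonCycles {V : Type*} [DecidableEq V] (G : SimpleGraph V) : Set G.Subgraph :=
  {C | ∃ (v : V) (p : G.Walk v v), p.IsHamiltonianCycle ∧ p.toSubgraph = C}

/-!
Write a subset of `{0, …, 2k}` as a cyclic binary word. Reading up-steps as opening and down-steps
as closing parentheses, a `k`-element set has a unique unmatched down-step, and cutting the word
after it leaves a Dyck word, that is, an ordered rooted tree with `k` edges; a `(k + 1)`-element set
has a unique unmatched up-step, and cutting before it has the same effect. So both levels are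
indexed by pairs `(t, s)` of a tree `t` and a position `s` modulo `2k + 1`: `vertex_injective` comes
from the cycle lemma, and surjectivity from the Catalan numbers.

Joining the lower vertex `(t, s)` to the upper vertices `(ρ t, s)` and `(t, s - 1)`, where `ρ` is the
rotation `1 u 0 v ↦ u 1 v 0` of rooted trees, gives a cycle factor. Its cycles correspond to the
orbits of `ρ`, i.e. to plane trees: going once around a tree shifts `s` by `2k = -1`
(`step_iterate_two_mul`).

Two trees `x = 1 1 0 u 0 v` and `y = 1 0 1 u 0 v`, which differ by pulling a leaf to the root, and a
position `s` define a 6-cycle of the middle levels graph which meets the factor in two edges of the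
cycle of `x` and one edge of the cycle of `y`; taking the symmetric difference glues the two cycles.
Every pull lowers the sum of the distances from the root; applied to a rooting for which that sum is
least, it lowers the minimum over all rootings (`exists_pull_of_ne_planeStar`). Choosing such a pull
for each plane tree other than the star, one obtains a tree of gluings with the star as its root.
The factor edges on the 6-cycles are pairwise distinct, so the result is described by a permutation
`gluing` of the factor edges, a product of disjoint 3-cycles. The glued graph is 2-regular
(`ncard_neighborSet_gluedGraph`) and connected (`connected_gluedGraph`), hence a Hamilton cycle.

The position of each gluing may be chosen freely from `{0, 1}`, and distinct choices give distinct
graphs (`gluedGraph_injective`). This gives `2 ^ (m - 1)` Hamilton cycles, where `m` is the number of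
plane trees with `k` edges. A plane tree has at most `2k` rootings, so `m` is at least the Catalan
number divided by `2k`, which exceeds `2 ^ (k - 6)` (`two_pow_lt_card_planeTree`).
-/

namespace MiddleLevels

open scoped BinaryTree

/-! ### Ordered rooted trees and rotation -/

/-- An ordered rooted tree, encoded by its first-child/next-sibling binary tree: `u △ v` is the
tree whose root has a first child carrying the subtree `u`, the rest of the tree being `v`. As a
Dyck word it is `1 u 0 v`. -/
abbrev OrderedTree : Type := BinaryTree Unit

/-- Identify the roots of two ordered trees; on Dyck words this is concatenation. -/
def append : OrderedTree → OrderedTree → OrderedTree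
  | .nil, t => t
  | .node _ u v, t => u △ append v t

@[simp] lemma nil_append (t : OrderedTree) : append .nil t = t := rfl

@[simp] lemma node_append (u v t : OrderedTree) : append (u △ v) t = u △ append v t := rfl

@[simp] lemma append_nil (t : OrderedTree) : append t .nil = t := by
  induction t using BinaryTree.unitRecOn with
  | base => rfl
  | ind u v _ hv => rw [node_append, hv]

lemma append_assoc (s t r : OrderedTree) :
    append (append s t) r = append s (append t r) := by
  induction s using BinaryTree.unitRecOn with
  | base => rfl
  | ind u v _ hv => rw [node_append, node_append, node_append, hv]

lemma numNodes_node (u v : OrderedTree) : (u △ v).numNodes = u.numNodes + v.numNodes + 1 := rfl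

@[simp] lemma numNodes_append (s t : OrderedTree) :
    (append s t).numNodes = s.numNodes + t.numNodes := by
  induction s using BinaryTree.unitRecOn with
  | base => simp [BinaryTree.numNodes]
  | ind u v _ hv => rw [node_append, numNodes_node, hv, numNodes_node]; omega

/-- Tree rotation: the root moves to its first child. On Dyck words it maps `1 u 0 v` to
`u 1 v 0`. -/
def rotate : OrderedTree → OrderedTree
  | .nil => .nil
  | .node _ u v => append u (v △ .nil)

@[simp] lemma rotate_node (u v : OrderedTree) : rotate (u △ v) = append u (v △ .nil) := rfl

@[simp] lemma numNodes_rotate (t : OrderedTree) : (rotate t).numNodes = t.numNodes := by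
  cases t with
  | nil => rfl
  | node _ u v =>
    rw [rotate_node, numNodes_append, numNodes_node, numNodes_node, BinaryTree.numNodes]; omega

/-- Walking around all edges of `s` moves `s` past `t`: each edge is traversed twice. -/
lemma rotate_iterate_append (s t : OrderedTree) :
    rotate^[2 * s.numNodes] (append s t) = append t s := by
  induction s using BinaryTree.unitRecOn generalizing t with
  | base => simp [BinaryTree.numNodes]
  | ind u v hu hv =>
    have h : 2 * (u △ v).numNodes = 2 * v.numNodes + 1 + (2 * u.numNodes + 1) := by
      rw [numNodes_node]; omega
    rw [h, Function.iterate_add_apply, Function.iterate_succ_apply _ (2 * u.numNodes),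
      node_append, rotate_node, hu, Function.iterate_succ_apply, node_append, nil_append,
      rotate_node, append_assoc, hv, append_assoc]
    rfl

lemma rotate_iterate_self (t : OrderedTree) : rotate^[2 * t.numNodes] t = t := by
  simpa using rotate_iterate_append t .nil

/-- Two ordered trees are equivalent if they differ by rotations; the classes are the plane
trees. -/
def RotEquiv (s t : OrderedTree) : Prop := ∃ m, rotate^[m] s = t

lemma numNodes_rotate_iterate (m : ℕ) (t : OrderedTree) :
    (rotate^[m] t).numNodes = t.numNodes := by
  induction m with
  | zero => rfl
  | succ m h => rw [Function.iterate_succ_apply', numNodes_rotate, h]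

namespace RotEquiv

lemma refl (t : OrderedTree) : RotEquiv t t := ⟨0, rfl⟩

lemma trans {s t r : OrderedTree} (h₁ : RotEquiv s t) (h₂ : RotEquiv t r) : RotEquiv s r := by
  obtain ⟨a, rfl⟩ := h₁
  obtain ⟨b, rfl⟩ := h₂
  exact ⟨b + a, Function.iterate_add_apply _ _ _ _⟩

lemma symm {s t : OrderedTree} (h : RotEquiv s t) : RotEquiv t s := by
  obtain ⟨a, rfl⟩ := h
  rcases Nat.eq_zero_or_pos s.numNodes with h0 | h0
  · cases s with
    | nil => exact ⟨0, Function.iterate_fixed (rfl : rotate .nil = .nil) a⟩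
    | node _ u v => simp [BinaryTree.numNodes] at h0
  · refine ⟨2 * s.numNodes * a - a, ?_⟩
    rw [← Function.iterate_add_apply,
      Nat.sub_add_cancel (Nat.le_mul_of_pos_left _ (by omega)), Function.iterate_mul]
    exact Function.iterate_fixed (rotate_iterate_self s) a

lemma numNodes_eq {s t : OrderedTree} (h : RotEquiv s t) : s.numNodes = t.numNodes := by
  obtain ⟨a, rfl⟩ := h
  exact (numNodes_rotate_iterate a s).symm

end RotEquiv

lemma rotEquiv_rotate (t : OrderedTree) : RotEquiv t (rotate t) := ⟨1, rfl⟩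

lemma rotEquiv_append_comm (s t : OrderedTree) : RotEquiv (append s t) (append t s) :=
  ⟨_, rotate_iterate_append s t⟩

lemma rotate_injective : Function.Injective rotate := by
  intro s t h
  have hn : s.numNodes = t.numNodes := by rw [← numNodes_rotate s, h, numNodes_rotate]
  rcases Nat.eq_zero_or_pos s.numNodes with h0 | h0
  · cases s with
    | nil =>
      cases t with
      | nil => rfl
      | node _ u v => simp [BinaryTree.numNodes] at hn
    | node _ u v => simp [BinaryTree.numNodes] at h0
  · have key (r : OrderedTree) (hr : r.numNodes = s.numNodes) :
        rotate^[2 * s.numNodes - 1] (rotate r) = r := by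
      rw [← Function.iterate_succ_apply, show (2 * s.numNodes - 1).succ = 2 * r.numNodes by omega,
        rotate_iterate_self]
    rw [← key s rfl, h, key t hn.symm]

/-! ### Pulling leaves towards the root -/

/-- The sum of the distances of all vertices from the root. -/
def depthSum : OrderedTree → ℕ
  | .nil => 0
  | .node _ u v => depthSum u + u.numNodes + 1 + depthSum v

lemma depthSum_node (u v : OrderedTree) :
    depthSum (u △ v) = depthSum u + u.numNodes + 1 + depthSum v := rfl

/-- The star with `n` edges, rooted at its centre. -/
def star : ℕ → OrderedTree
  | 0 => .nil
  | n + 1 => .nil △ star n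

@[simp] lemma numNodes_star (n : ℕ) : (star n).numNodes = n := by
  induction n with
  | zero => rfl
  | succ n h => rw [star, numNodes_node, h, BinaryTree.numNodes]; omega

/-- `Pull s t`: the tree `t` arises from `s` by moving a leaf that is the first child of a
non-root vertex `c` so that it becomes the sibling just before `c`. On Dyck words, a factor
`1 1 0 u 0` is replaced by `1 0 1 u 0`. -/
inductive Pull : OrderedTree → OrderedTree → Prop
  | base (u v : OrderedTree) : Pull ((.nil △ u) △ v) (.nil △ u △ v)
  | left {u u' : OrderedTree} (v : OrderedTree) : Pull u u' → Pull (u △ v) (u' △ v)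
  | right (u : OrderedTree) {v v' : OrderedTree} : Pull v v' → Pull (u △ v) (u △ v')

lemma Pull.numNodes_eq {s t : OrderedTree} (h : Pull s t) : s.numNodes = t.numNodes := by
  induction h with
  | base u v => simp only [BinaryTree.numNodes]; omega
  | left v _ h => rw [numNodes_node, numNodes_node, h]
  | right u _ h => rw [numNodes_node, numNodes_node, h]

lemma Pull.depthSum_lt {s t : OrderedTree} (h : Pull s t) : depthSum t < depthSum s := by
  induction h with
  | base u v => simp only [BinaryTree.numNodes, depthSum]; omega
  | left v h' h => rw [depthSum_node, depthSum_node, h'.numNodes_eq]; omega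
  | right u _ h => rw [depthSum_node, depthSum_node]; omega

lemma eq_star_or_exists_pull (t : OrderedTree) : t = star t.numNodes ∨ ∃ t', Pull t t' := by
  induction t using BinaryTree.unitRecOn with
  | base => exact .inl rfl
  | ind u v hu hv =>
    rcases hv with hv | ⟨v', hv⟩
    · rcases hu with hu | ⟨u', hu⟩
      · cases u with
        | nil =>
          left
          rw [numNodes_node, BinaryTree.numNodes, Nat.zero_add, star, ← hv]
        | node _ a b =>
          cases a with
          | nil => exact .inr ⟨_, .base b v⟩
          | node _ c d => rw [numNodes_node, star] at hu; simp at hu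
      · exact .inr ⟨_, hu.left v⟩
    · exact .inr ⟨_, hv.right u⟩

/-- Up to rotation, every pull takes place at the root. The factor `r` on the right lets the
induction go through: it absorbs the part of the tree outside the subtree under consideration. -/
lemma Pull.exists_rotEquiv_append {s t : OrderedTree} (h : Pull s t) (r : OrderedTree) :
    ∃ u v, RotEquiv (append s r) ((.nil △ u) △ v) ∧ RotEquiv (append t r) (.nil △ u △ v) := by
  induction h generalizing r with
  | base u v => exact ⟨u, append v r, .refl _, .refl _⟩
  | left b _ h =>
    obtain ⟨u, v, h₁, h₂⟩ := h (append b r △ .nil)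
    exact ⟨u, v, (rotEquiv_rotate _).trans h₁, (rotEquiv_rotate _).trans h₂⟩
  | right a _ h =>
    obtain ⟨u, v, h₁, h₂⟩ := h (append r (a △ .nil))
    rw [← append_assoc] at h₁ h₂
    exact ⟨u, v, (rotEquiv_append_comm (a △ .nil) _).trans h₁,
      (rotEquiv_append_comm (a △ .nil) _).trans h₂⟩

lemma Pull.exists_rotEquiv {s t : OrderedTree} (h : Pull s t) :
    ∃ u v, RotEquiv s ((.nil △ u) △ v) ∧ RotEquiv t (.nil △ u △ v) := by
  simpa using h.exists_rotEquiv_append .nil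

/-! ### Plane trees -/

/-- The ordered rooted trees with `n` edges. -/
abbrev TreeOfSize (n : ℕ) : Type := {t : OrderedTree // t.numNodes = n}

instance (n : ℕ) : Fintype (TreeOfSize n) :=
  Fintype.subtype (BinaryTree.treesOfNumNodesEq n) fun _ => BinaryTree.mem_treesOfNumNodesEq

lemma card_treeOfSize (n : ℕ) : Fintype.card (TreeOfSize n) = catalan n := by
  rw [← BinaryTree.treesOfNumNodesEq_card_eq_catalan]
  exact Fintype.card_of_subtype _ fun _ => BinaryTree.mem_treesOfNumNodesEq

/-- The setoid on ordered trees with `n` edges whose classes are the plane trees. -/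
def planeSetoid (n : ℕ) : Setoid (TreeOfSize n) where
  r s t := RotEquiv s.1 t.1
  iseqv := ⟨fun _ => .refl _, fun h => h.symm, fun h h' => h.trans h'⟩

/-- Plane trees with `n` edges: ordered rooted trees up to rotation. -/
abbrev PlaneTree (n : ℕ) : Type := Quotient (planeSetoid n)

/-- The plane tree underlying an ordered rooted tree. -/
def plane {n : ℕ} (t : TreeOfSize n) : PlaneTree n := Quotient.mk (planeSetoid n) t

lemma plane_eq_iff {n : ℕ} {s t : TreeOfSize n} : plane s = plane t ↔ RotEquiv s.1 t.1 :=
  Quotient.eq (r := planeSetoid n)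

lemma plane_surjective (n : ℕ) : Function.Surjective (plane (n := n)) := Quotient.mk_surjective

/-- The plane star. -/
def planeStar (n : ℕ) : PlaneTree n := plane ⟨star n, numNodes_star n⟩

/-- The least sum of distances from a root, over all rootings of a plane tree. -/
noncomputable def potential {n : ℕ} (q : PlaneTree n) : ℕ :=
  sInf {d | ∃ t : TreeOfSize n, plane t = q ∧ depthSum t.1 = d}

lemma potential_le {n : ℕ} (t : TreeOfSize n) : potential (plane t) ≤ depthSum t.1 :=
  Nat.sInf_le ⟨t, rfl, rfl⟩

lemma exists_depthSum_eq_potential {n : ℕ} (q : PlaneTree n) :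
    ∃ t, plane t = q ∧ depthSum t.1 = potential q := by
  obtain ⟨t, rfl⟩ := plane_surjective n q
  exact Nat.sInf_mem (s := {d | ∃ s : TreeOfSize n, plane s = plane t ∧ depthSum s.1 = d})
    ⟨_, t, rfl, rfl⟩

/-- Rooted so that the sum of distances is least, a plane tree other than the star admits a pull,
which lowers that sum. -/
lemma exists_pull_of_ne_planeStar {n : ℕ} {q : PlaneTree n} (hq : q ≠ planeStar n) :
    ∃ (u v : OrderedTree) (hx : ((.nil △ u) △ v).numNodes = n)
      (hy : (.nil △ u △ v).numNodes = n),
      plane ⟨(.nil △ u) △ v, hx⟩ = q ∧ potential (plane ⟨.nil △ u △ v, hy⟩) < potential q := by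
  obtain ⟨t, rfl, ht⟩ := exists_depthSum_eq_potential q
  rcases eq_star_or_exists_pull t.1 with h | ⟨t', h⟩
  · refine absurd ?_ hq
    rw [planeStar, plane_eq_iff, h, t.2]
    exact .refl _
  · obtain ⟨u, v, hu, hv⟩ := h.exists_rotEquiv
    have ht' : t'.numNodes = n := h.numNodes_eq ▸ t.2
    refine ⟨u, v, hu.numNodes_eq ▸ t.2, hv.numNodes_eq ▸ ht', plane_eq_iff.2 hu.symm, ?_⟩
    have h₁ := potential_le ⟨t', ht'⟩
    rw [plane_eq_iff.2 (show RotEquiv (⟨t', ht'⟩ : TreeOfSize n).1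
      (⟨.nil △ u △ v, hv.numNodes_eq ▸ ht'⟩ : TreeOfSize n).1 from hv)] at h₁
    exact ht ▸ h₁.trans_lt h.depthSum_lt

lemma card_le_mul_card_planeTree {n : ℕ} (hn : 1 ≤ n) :
    catalan n ≤ 2 * n * Nat.card (PlaneTree n) := by
  classical
  rw [← card_treeOfSize, Nat.card_eq_fintype_card, ← Finset.card_univ,
    ← Finset.card_univ (α := PlaneTree n)]
  refine Finset.card_le_mul_card_image_of_maps_to (f := plane) (fun _ _ => Finset.mem_univ _) _ ?_
  intro q _
  obtain ⟨t, rfl⟩ := plane_surjective n q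
  refine (Finset.card_le_card_of_injOn (t := (Finset.range (2 * n)).image fun m => rotate^[m] t.1)
    (fun s => s.1) ?_ fun _ _ _ _ h => Subtype.ext h).trans
    (Finset.card_image_le.trans (Finset.card_range _).le)
  intro s hs
  obtain ⟨m, hm⟩ := plane_eq_iff.1 (Finset.mem_filter.1 hs).2.symm
  refine Finset.mem_coe.2 (Finset.mem_image.2 ⟨m % (2 * n), ?_, ?_⟩)
  · exact Finset.mem_range.2 (Nat.mod_lt _ (by omega))
  · have h : Function.IsPeriodicPt rotate (2 * n) t.1 := by
      have := rotate_iterate_self t.1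
      rwa [t.2] at this
    rw [h.iterate_mod_apply, hm]

/-- There are more than `2 ^ (n - 6)` plane trees with `n ≥ 6` edges, since each of them has at
most `2 n` rootings. -/
lemma two_pow_lt_card_planeTree {n : ℕ} (hn : 6 ≤ n) :
    2 ^ (n - 6) < Nat.card (PlaneTree n) := by
  have h₁ := card_le_mul_card_planeTree (n := n) (by omega)
  have h₂ := succ_mul_catalan_eq_centralBinom n
  have h₃ := Nat.four_pow_le_two_mul_self_mul_centralBinom n (by omega)
  have h₄ : 4 * n ^ 2 * (n + 1) * 2 ^ (n - 6) < 4 ^ n := by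
    clear h₁ h₂ h₃
    induction n, hn using Nat.le_induction with
    | base => norm_num
    | succ n hn ih =>
      have : 4 * (n + 1) ^ 2 * (n + 1 + 1) ≤ 2 * (4 * n ^ 2 * (n + 1)) := by nlinarith
      calc 4 * (n + 1) ^ 2 * (n + 1 + 1) * 2 ^ (n + 1 - 6)
          = 4 * (n + 1) ^ 2 * (n + 1 + 1) * (2 * 2 ^ (n - 6)) := by
            rw [show n + 1 - 6 = n - 6 + 1 by omega, pow_succ' 2 (n - 6)]
        _ ≤ 2 * (4 * n ^ 2 * (n + 1)) * (2 * 2 ^ (n - 6)) := Nat.mul_le_mul_right _ this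
        _ = 4 * (4 * n ^ 2 * (n + 1) * 2 ^ (n - 6)) := by ring
        _ < 4 ^ (n + 1) := by rw [pow_succ 4 n]; omega
  rw [← h₂] at h₃
  by_contra! h
  have : 2 * n * ((n + 1) * catalan n) ≤ 4 * n ^ 2 * (n + 1) * 2 ^ (n - 6) :=
    calc 2 * n * ((n + 1) * catalan n)
        ≤ 2 * n * ((n + 1) * (2 * n * 2 ^ (n - 6))) := by gcongr; exact h₁.trans (by gcongr)
      _ = 4 * n ^ 2 * (n + 1) * 2 ^ (n - 6) := by ring
  omega

/-! ### Dyck words -/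

/-- The Dyck word of an ordered tree; `true` is an up-step and `false` a down-step. -/
def word : OrderedTree → List Bool
  | .nil => []
  | .node _ u v => true :: (word u ++ false :: word v)

@[simp] lemma word_nil : word .nil = [] := rfl

@[simp] lemma word_node (a : Unit) (u v : OrderedTree) :
    word (.node a u v) = true :: (word u ++ false :: word v) := rfl

@[simp] lemma word_append (s t : OrderedTree) : word (append s t) = word s ++ word t := by
  induction s using BinaryTree.unitRecOn with
  | base => rfl
  | ind u v _ hv => simp [hv]

lemma count_true_word (t : OrderedTree) : (word t).count true = t.numNodes := by
  induction t using BinaryTree.unitRecOn with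
  | base => rfl
  | ind u v hu hv => simp [hu, hv, BinaryTree.numNodes]; try omega

lemma length_word (t : OrderedTree) : (word t).length = 2 * t.numNodes := by
  induction t using BinaryTree.unitRecOn with
  | base => rfl
  | ind u v hu hv => simp [hu, hv, BinaryTree.numNodes]; try omega

/-- A Dyck word followed by a down-step is the part of a word up to the first return below zero,
so it can be read off from any continuation. -/
lemma word_append_false_cons_inj {s t : OrderedTree} {l m : List Bool}
    (h : word s ++ false :: l = word t ++ false :: m) : s = t ∧ l = m := by
  induction s using BinaryTree.unitRecOn generalizing t l m with
  | base =>
    cases t with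
    | nil => simpa using h
    | node _ u v => simp at h
  | ind u v hu hv =>
    cases t with
    | nil => simp at h
    | node _ a b =>
      simp only [word_node, List.cons_append, List.append_assoc, List.cons.injEq, true_and] at h
      obtain ⟨rfl, h₁⟩ := hu h
      obtain ⟨rfl, h₂⟩ := hv h₁
      exact ⟨rfl, h₂⟩

lemma word_injective : Function.Injective word := fun s t h =>
  (word_append_false_cons_inj (l := []) (m := []) (by rw [h])).1

/-- The number of up-steps minus the number of down-steps. -/
def excess (l : List Bool) : ℤ := (l.map fun b => if b then (1 : ℤ) else -1).sum

@[simp] lemma excess_nil : excess [] = 0 := rfl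

@[simp] lemma excess_cons_true (l : List Bool) : excess (true :: l) = 1 + excess l := by
  simp [excess]

@[simp] lemma excess_cons_false (l : List Bool) : excess (false :: l) = -1 + excess l := by
  simp [excess]

@[simp] lemma excess_append (l m : List Bool) : excess (l ++ m) = excess l + excess m := by
  simp [excess]

lemma excess_word (t : OrderedTree) : excess (word t) = 0 := by
  induction t using BinaryTree.unitRecOn with
  | base => rfl
  | ind u v hu hv => simp [hu, hv]

lemma excess_take_word_nonneg (t : OrderedTree) (i : ℕ) : 0 ≤ excess ((word t).take i) := by
  induction t using BinaryTree.unitRecOn generalizing i with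
  | base => simp
  | ind u v hu hv =>
    cases i with
    | zero => simp
    | succ j =>
      rw [word_node, List.take_succ_cons, excess_cons_true, List.take_append, excess_append]
      rcases Nat.eq_zero_or_pos (j - (word u).length) with h | h
      · rw [h, List.take_zero, excess_nil]
        linarith [hu j]
      · obtain ⟨m, hm⟩ := Nat.exists_eq_succ_of_ne_zero h.ne'
        rw [List.take_of_length_le (by omega), hm, List.take_succ_cons, excess_cons_false,
          excess_word]
        linarith [hv m]

/-- The Dyck word of a tree followed by an unmatched down-step. -/
def lowerWord (t : OrderedTree) : List Bool := word t ++ [false]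

/-- The Dyck word of a tree preceded by an unmatched up-step. -/
def upperWord (t : OrderedTree) : List Bool := true :: word t

lemma length_lowerWord (t : OrderedTree) : (lowerWord t).length = 2 * t.numNodes + 1 := by
  simp [lowerWord, length_word]

lemma length_upperWord (t : OrderedTree) : (upperWord t).length = 2 * t.numNodes + 1 := by
  simp [upperWord, length_word]

lemma excess_take_lowerWord_nonneg (t : OrderedTree) {i : ℕ} (hi : i < (lowerWord t).length) :
    0 ≤ excess ((lowerWord t).take i) := by
  rw [lowerWord, List.take_append_of_le_length (by simpa [lowerWord, Nat.lt_succ_iff] using hi)]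
  exact excess_take_word_nonneg t i

lemma excess_take_upperWord_pos (t : OrderedTree) {i : ℕ} (hi : 0 < i) :
    0 < excess ((upperWord t).take i) := by
  obtain ⟨j, rfl⟩ := Nat.exists_eq_succ_of_ne_zero hi.ne'
  rw [upperWord, List.take_succ_cons, excess_cons_true]
  linarith [excess_take_word_nonneg t j]

lemma rotate_eq_drop_append_take' {l : List Bool} {d : ℕ} (hd : d < l.length) :
    (l.rotate d).take (l.length - d) = l.drop d := by
  rw [List.rotate_eq_drop_append_take hd.le, ← List.length_drop, List.take_left]

/-- Uniqueness in the cycle lemma: splitting off a proper nonempty prefix of a lower word and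
moving it to the end gives a second factorisation into two parts, both of nonnegative excess,
whereas the total excess is `-1`. -/
lemma lowerWord_rotate_ne {s t : OrderedTree} {d : ℕ} (h0 : 0 < d)
    (hd : d < (lowerWord s).length) : (lowerWord s).rotate d ≠ lowerWord t := by
  intro h
  have hl : (lowerWord t).length = (lowerWord s).length := by rw [← h, List.length_rotate]
  have h₁ := excess_take_lowerWord_nonneg s hd
  have h₂ := excess_take_lowerWord_nonneg t (i := (lowerWord s).length - d) (by omega)
  rw [← h, rotate_eq_drop_append_take' hd] at h₂
  have h₃ : excess ((lowerWord s).take d ++ (lowerWord s).drop d) = -1 := by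
    rw [List.take_append_drop, lowerWord, excess_append, excess_word]; rfl
  rw [excess_append] at h₃
  omega

lemma upperWord_rotate_ne {s t : OrderedTree} {d : ℕ} (h0 : 0 < d)
    (hd : d < (upperWord s).length) : (upperWord s).rotate d ≠ upperWord t := by
  intro h
  have h₁ := excess_take_upperWord_pos s h0
  have h₂ := excess_take_upperWord_pos t (i := (upperWord s).length - d) (by omega)
  rw [← h, rotate_eq_drop_append_take' hd] at h₂
  have h₃ : excess ((upperWord s).take d ++ (upperWord s).drop d) = 1 := by
    rw [List.take_append_drop, upperWord, excess_cons_true, excess_word]; rfl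
  rw [excess_append] at h₃
  omega

/-! ### Cyclic placements of words -/

section Place

variable {N : ℕ} [NeZero N]

/-- Write the word `W` cyclically around `{0, …, N - 1}`, starting at position `s`; the result is
the set of positions that carry `true`. -/
def place (W : List Bool) (s : ZMod N) : Finset (Fin N) :=
  {p | W[(ZMod.finEquiv N p - s).val]? = some true}

lemma mem_place {W : List Bool} {s : ZMod N} {p : Fin N} :
    p ∈ place W s ↔ W[(ZMod.finEquiv N p - s).val]? = some true := by
  simp [place]

lemma place_rotate {W : List Bool} (hW : W.length = N) (s d : ZMod N) :
    place (W.rotate d.val) (s + d) = place W s := by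
  ext p
  rw [mem_place, mem_place, List.getElem?_rotate (hW.symm ▸ ZMod.val_lt _), hW, ← ZMod.val_add]
  congr! 3
  ring

lemma place_cons {b : Bool} {W : List Bool} (hW : (b :: W).length = N) (s : ZMod N) :
    place (b :: W) s = place (W ++ [b]) (s + 1) := by
  rw [← place_rotate hW s 1, ZMod.val_one_eq_one_mod]
  have h := List.rotate_mod (b :: W) 1
  rw [hW] at h
  rw [h, List.rotate_cons_succ, List.rotate_zero]

lemma place_injective_left {W W' : List Bool} (hW : W.length = N) (hW' : W'.length = N)
    {s : ZMod N} (h : place W s = place W' s) : W = W' := by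
  refine List.ext_getElem (hW.trans hW'.symm) fun i hi hi' => ?_
  have key := Finset.ext_iff.1 h ((ZMod.finEquiv N).symm (s + i))
  rw [mem_place, mem_place, RingEquiv.apply_symm_apply, add_sub_cancel_left,
    ZMod.val_cast_of_lt (hW ▸ hi), List.getElem?_eq_getElem hi, List.getElem?_eq_getElem hi',
    Option.some_inj, Option.some_inj] at key
  exact Bool.eq_iff_iff.2 key

lemma card_place {W : List Bool} (hW : W.length = N) (s : ZMod N) :
    (place W s).card = W.count true := by
  have h := Fin.card_filter_univ_eq_vector_get_eq_count true ⟨W, hW⟩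
  rw [List.Vector.toList_mk] at h
  rw [← h]
  refine Finset.card_bij (fun p _ => ⟨(ZMod.finEquiv N p - s).val, ZMod.val_lt _⟩) ?_ ?_ ?_
  · intro p hp
    rw [mem_place, List.getElem?_eq_getElem (hW.symm ▸ ZMod.val_lt _), Option.some_inj] at hp
    exact Finset.mem_filter.2 ⟨Finset.mem_univ _, by simpa [List.Vector.get] using hp⟩
  · intro p _ q _ hpq
    exact (ZMod.finEquiv N).injective (sub_left_injective (ZMod.val_injective N (Fin.mk.inj hpq)))
  · intro i hi
    have hv : (ZMod.finEquiv N ((ZMod.finEquiv N).symm (s + (i : ℕ))) - s).val = i := by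
      rw [RingEquiv.apply_symm_apply, add_sub_cancel_left, ZMod.val_cast_of_lt i.2]
    refine ⟨(ZMod.finEquiv N).symm (s + (i : ℕ)), ?_, Fin.ext hv⟩
    rw [mem_place, hv, List.getElem?_eq_getElem (hW.symm ▸ i.2), Option.some_inj]
    simpa [List.Vector.get] using (Finset.mem_filter.1 hi).2

lemma place_flip_subset (P Q : List Bool) (s : ZMod N) :
    place (P ++ false :: Q) s ⊆ place (P ++ true :: Q) s := by
  intro p
  rw [mem_place, mem_place]
  generalize (ZMod.finEquiv N p - s).val = i
  rw [List.getElem?_append, List.getElem?_append, List.getElem?_cons, List.getElem?_cons]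
  split_ifs <;> simp

/-- Placements of words of a family are pairwise distinct if no proper rotation of a word of the
family is again in the family. -/
lemma place_injective {ι : Type*} {w : ι → List Bool} (hw : Function.Injective w)
    (hl : ∀ a, (w a).length = N)
    (hr : ∀ (a b : ι) (d : ℕ), 0 < d → d < N → (w a).rotate d ≠ w b) :
    Function.Injective fun q : ι × ZMod N => place (w q.1) q.2 := by
  rintro ⟨a, s⟩ ⟨b, t⟩ (h : place (w a) s = place (w b) t)
  rw [← place_rotate (hl a) s (t - s), add_sub_cancel] at h
  have h' := place_injective_left (by rw [List.length_rotate, hl]) (hl b) h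
  rcases Nat.eq_zero_or_pos (t - s).val with h0 | h0
  · rw [h0, List.rotate_zero] at h'
    rw [ZMod.val_eq_zero, sub_eq_zero] at h0
    rw [hw h', h0]
  · exact absurd h' (hr a b _ h0 (ZMod.val_lt _))

end Place

/-! ### Vertices of the middle levels graph -/

/-- Indices for the vertices of one level: an ordered tree together with a position. -/
abbrev Index (k : ℕ) : Type := TreeOfSize k × ZMod (2 * k + 1)

/-- The `k`-element set encoded by a tree and a position. -/
def lowerSet {k : ℕ} (p : Index k) : Finset (Fin (2 * k + 1)) := place (lowerWord p.1.1) p.2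

/-- The `(k + 1)`-element set encoded by a tree and a position. -/
def upperSet {k : ℕ} (p : Index k) : Finset (Fin (2 * k + 1)) := place (upperWord p.1.1) p.2

variable {k : ℕ}

lemma TreeOfSize.length_lowerWord (t : TreeOfSize k) : (lowerWord t.1).length = 2 * k + 1 := by
  rw [MiddleLevels.length_lowerWord, t.2]

lemma TreeOfSize.length_upperWord (t : TreeOfSize k) : (upperWord t.1).length = 2 * k + 1 := by
  rw [MiddleLevels.length_upperWord, t.2]

lemma card_lowerSet (p : Index k) : (lowerSet p).card = k := by
  rw [lowerSet, card_place p.1.length_lowerWord, lowerWord, List.count_append, count_true_word,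
    p.1.2]
  rfl

lemma card_upperSet (p : Index k) : (upperSet p).card = k + 1 := by
  rw [upperSet, card_place p.1.length_upperWord, upperWord, List.count_cons_self,
    count_true_word, p.1.2]

lemma lowerSet_injective : Function.Injective (lowerSet (k := k)) :=
  place_injective (w := fun t : TreeOfSize k => lowerWord t.1)
    (fun _ _ h => Subtype.ext (word_injective (List.append_cancel_right h)))
    TreeOfSize.length_lowerWord
    fun a _ _ h0 hd => lowerWord_rotate_ne h0 (hd.trans_eq a.length_lowerWord.symm)

lemma upperSet_injective : Function.Injective (upperSet (k := k)) :=
  place_injective (w := fun t : TreeOfSize k => upperWord t.1)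
    (fun _ _ h => Subtype.ext (word_injective (List.cons.inj h).2))
    TreeOfSize.length_upperWord
    fun a _ _ h0 hd => upperWord_rotate_ne h0 (hd.trans_eq a.length_upperWord.symm)

/-- The vertices of the middle levels graph, indexed by pairs of a tree and a position in each of
the two levels. -/
def vertex : Index k ⊕ Index k → BipartiteKneserVertex (2 * k + 1) k
  | .inl p => ⟨lowerSet p, .inl (card_lowerSet p)⟩
  | .inr p => ⟨upperSet p, .inr (by rw [card_upperSet]; omega)⟩

lemma vertex_injective : Function.Injective (vertex (k := k)) := by
  rintro (p | p) (q | q) h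
  · exact congrArg _ (lowerSet_injective (Subtype.ext_iff.1 h))
  · have := congrArg (fun v => v.1.card) h
    simp [vertex, card_lowerSet, card_upperSet] at this
  · have := congrArg (fun v => v.1.card) h
    simp [vertex, card_lowerSet, card_upperSet] at this
  · exact congrArg _ (upperSet_injective (Subtype.ext_iff.1 h))

lemma card_index (k : ℕ) : Fintype.card (Index k) = (2 * k + 1).choose k := by
  have h₁ := Nat.add_one_mul_choose_eq (2 * k) k
  have h₂ := succ_mul_catalan_eq_centralBinom k
  rw [Nat.centralBinom_eq_two_mul_choose] at h₂
  rw [Fintype.card_prod, card_treeOfSize, ZMod.card]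
  refine Nat.eq_of_mul_eq_mul_left (Nat.succ_pos k) ?_
  rw [← Nat.choose_symm_half, Nat.succ_eq_add_one, mul_comm (k + 1) (Nat.choose _ _), ← h₁, ← h₂]
  ring

lemma card_bipartiteKneserVertex (k : ℕ) :
    Fintype.card (BipartiteKneserVertex (2 * k + 1) k) = 2 * (2 * k + 1).choose k := by
  have h : Disjoint (fun s : Finset (Fin (2 * k + 1)) => s.card = k)
      fun s => s.card + k = 2 * k + 1 := by
    rw [Pi.disjoint_iff]
    intro s
    rw [Prop.disjoint_iff]
    omega
  rw [Fintype.card_subtype_or_disjoint _ _ h, Fintype.card_finset_len]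
  have h' : ∀ s : Finset (Fin (2 * k + 1)), s.card + k = 2 * k + 1 ↔ s.card = k + 1 := by
    intro s; omega
  simp only [h', Fintype.card_finset_len, Fintype.card_fin, Nat.choose_symm_half]
  ring

lemma vertex_bijective : Function.Bijective (vertex (k := k)) := by
  rw [Fintype.bijective_iff_injective_and_card]
  refine ⟨vertex_injective, ?_⟩
  rw [card_bipartiteKneserVertex, Fintype.card_sum, card_index]
  ring

/-- Flipping one down-step to an up-step in a cyclic word gives an edge. -/
lemma adj_vertex {p q : Index k} {P Q : List Bool} {s : ZMod (2 * k + 1)}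
    (hp : lowerSet p = place (P ++ false :: Q) s) (hq : upperSet q = place (P ++ true :: Q) s) :
    (bipartiteKneserGraph (2 * k + 1) k).Adj (vertex (.inl p)) (vertex (.inr q)) := by
  refine .inl (Finset.ssubset_iff_subset_ne.2 ⟨?_, fun h => ?_⟩)
  · change lowerSet p ⊆ upperSet q
    rw [hp, hq]
    exact place_flip_subset P Q s
  · have := congrArg Finset.card (show lowerSet p = upperSet q from h)
    simp [card_lowerSet, card_upperSet] at this

/-- Rotation of ordered trees with `k` edges. -/
noncomputable def rot : Equiv.Perm (TreeOfSize k) :=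
  Equiv.ofBijective (fun t => ⟨rotate t.1, (numNodes_rotate _).trans t.2⟩)
    (Finite.injective_iff_bijective.1 fun _ _ h =>
      Subtype.ext (rotate_injective (Subtype.ext_iff.1 h)))

lemma coe_rot (t : TreeOfSize k) : (rot t).1 = rotate t.1 := rfl

lemma adj_vertex_rot (t : TreeOfSize k) (s : ZMod (2 * k + 1)) (hk : 1 ≤ k) :
    (bipartiteKneserGraph (2 * k + 1) k).Adj (vertex (.inl (t, s)))
      (vertex (.inr (rot t, s))) := by
  obtain ⟨t, ht⟩ := t
  cases t with
  | nil => simp [BinaryTree.numNodes] at ht; omega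
  | node _ u v =>
    refine adj_vertex (P := true :: word u) (Q := word v ++ [false]) (s := s) ?_ ?_
    · simp [lowerSet, lowerWord]
    · simp [upperSet, upperWord, coe_rot, rotate]

lemma adj_vertex_succ (t : TreeOfSize k) (s : ZMod (2 * k + 1)) :
    (bipartiteKneserGraph (2 * k + 1) k).Adj (vertex (.inl (t, s + 1))) (vertex (.inr (t, s))) :=
  adj_vertex (P := []) (Q := word t.1) (s := s)
    (place_cons (by simp [length_word, t.2]) s).symm rfl

/-! ### The 6-cycles -/

section Hexagon

variable {u v : OrderedTree} {x y : TreeOfSize k} (s : ZMod (2 * k + 1))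

/-- For `x = 1 1 0 u 0 v` and `y = 1 0 1 u 0 v`, this and the next two lemmas give the edges of the
6-cycle `1 1 0 u 0 v 0`, `1 1 0 u 1 v 0`, `1 0 0 u 1 v 0`, `1 0 1 u 1 v 0`, `1 0 1 u 0 v 0`,
`1 1 1 u 0 v 0` that do not belong to the cycle factor. Its lower vertices are those of `x`,
`rot (rot (rot x))` and `y`, its upper vertices those of `rot x`, `rot (rot (rot x))` and
`rot y`. -/
lemma adj_vertex_hexagon₁ (hx : x.1 = (.nil △ u) △ v) (hy : y.1 = .nil △ u △ v) :
    (bipartiteKneserGraph (2 * k + 1) k).Adj (vertex (.inl (x, s)))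
      (vertex (.inr (rot y, s))) := by
  refine adj_vertex (P := [true, true]) (Q := word u ++ false :: (word v ++ [false])) (s := s) ?_ ?_
  · simp [lowerSet, lowerWord, hx]
  · simp [upperSet, upperWord, coe_rot, hy]

lemma adj_vertex_hexagon₂ (hx : x.1 = (.nil △ u) △ v) (hy : y.1 = .nil △ u △ v) :
    (bipartiteKneserGraph (2 * k + 1) k).Adj (vertex (.inl (y, s)))
      (vertex (.inr (rot (rot (rot x)), s + 1 + 1))) := by
  have hl := length_word u
  have hl' := length_word v
  have hn := x.2
  simp only [hx, BinaryTree.numNodes] at hn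
  refine adj_vertex (P := [true, false, true] ++ word u) (Q := word v ++ [false]) (s := s) ?_ ?_
  · simp [lowerSet, lowerWord, hy]
  · rw [List.append_assoc, List.cons_append, List.cons_append, place_cons, List.cons_append,
      place_cons]
    · simp [upperSet, upperWord, coe_rot, hx, append_assoc]
    all_goals simp; omega

lemma adj_vertex_hexagon₃ (hx : x.1 = (.nil △ u) △ v) :
    (bipartiteKneserGraph (2 * k + 1) k).Adj
      (vertex (.inl (rot (rot (rot x)), s + 1 + 1 + 1))) (vertex (.inr (rot x, s))) := by
  have hl := length_word u
  have hl' := length_word v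
  have hn := x.2
  simp only [hx, BinaryTree.numNodes] at hn
  refine adj_vertex (P := [true]) (Q := false :: (word u ++ true :: (word v ++ [false]))) (s := s)
    ?_ ?_
  · rw [List.cons_append, List.nil_append, place_cons, List.cons_append, place_cons,
      List.cons_append, List.cons_append, place_cons]
    · simp [lowerSet, lowerWord, coe_rot, hx, append_assoc]
    all_goals simp; omega
  · simp [upperSet, upperWord, coe_rot, hx]

end Hexagon

/-! ### The cycle factor -/

/-- Edges of the cycle factor. The edge `(p, true)` leads from the lower vertex `p = (t, s)` to the
upper vertex `(rot t, s)`, and `(p, false)` leads from `p` to the upper vertex `(t, s - 1)`. -/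
abbrev FactorEdge (k : ℕ) : Type := Index k × Bool

/-- The upper end of an edge of the cycle factor. -/
noncomputable def upperEnd : FactorEdge k → Index k
  | ((t, s), true) => (rot t, s)
  | ((t, s), false) => (t, s - 1)

/-- The successor of a lower vertex along its cycle of the factor. -/
noncomputable def step (p : Index k) : Index k := (rot p.1, p.2 + 1)

lemma upperEnd_step (p : Index k) : upperEnd (step p, false) = upperEnd (p, true) := by
  simp [upperEnd, step]

lemma upperEnd_eq_iff (e : FactorEdge k) (q : Index k) :
    upperEnd e = q ↔ e = ((rot.symm q.1, q.2), true) ∨ e = ((q.1, q.2 + 1), false) := by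
  obtain ⟨⟨t, s⟩, _ | _⟩ := e <;> obtain ⟨t', s'⟩ := q
  · simp [upperEnd, sub_eq_iff_eq_add]
  · simp [upperEnd, Equiv.eq_symm_apply]

lemma plane_rot (t : TreeOfSize k) : plane (rot t) = plane t :=
  plane_eq_iff.2 (rotEquiv_rotate t.1).symm

lemma coe_rot_iterate (m : ℕ) (t : TreeOfSize k) : (rot^[m] t).1 = rotate^[m] t.1 := by
  induction m with
  | zero => rfl
  | succ m h => rw [Function.iterate_succ_apply', Function.iterate_succ_apply', coe_rot, h]

lemma step_iterate (m : ℕ) (p : Index k) : step^[m] p = (rot^[m] p.1, p.2 + m) := by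
  induction m with
  | zero => simp
  | succ m h =>
    rw [Function.iterate_succ_apply', h, Function.iterate_succ_apply', step, Nat.cast_succ,
      add_assoc]

/-- Walking once around a tree shifts the position by `2 k = -1`. Hence a cycle of the factor
comprises all positions of all rootings of a plane tree. -/
lemma step_iterate_two_mul (p : Index k) : step^[2 * k] p = (p.1, p.2 - 1) := by
  have h : ((2 * k : ℕ) : ZMod (2 * k + 1)) = -1 := by
    rw [eq_neg_iff_add_eq_zero]
    exact_mod_cast ZMod.natCast_self (2 * k + 1)
  rw [step_iterate, h, ← sub_eq_add_neg]
  refine Prod.ext (Subtype.ext ?_) rfl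
  rw [coe_rot_iterate]
  have := rotate_iterate_self p.1.1
  rwa [p.1.2] at this

lemma plane_step_iterate (m : ℕ) (p : Index k) : plane (step^[m] p).1 = plane p.1 := by
  induction m with
  | zero => rfl
  | succ m h => rw [Function.iterate_succ_apply', step, plane_rot, h]

lemma natCast_ne_zero {m : ℕ} (h0 : 0 < m) (h : m < 2 * k + 1) : (m : ZMod (2 * k + 1)) ≠ 0 := by
  rw [Ne, ZMod.natCast_eq_zero_iff]
  exact fun h' => (Nat.le_of_dvd h0 h').not_gt h

/-! ### Gluing cycles -/

/-- The plane trees other than the star; each of them indexes a gluing of its cycle with a cycle of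
lower potential. -/
abbrev NonStar (k : ℕ) : Type := {q : PlaneTree k // q ≠ planeStar k}

lemma exists_gluing_pair (j : NonStar k) : ∃ z : TreeOfSize k × TreeOfSize k,
    (∃ u v : OrderedTree, z.1.1 = (.nil △ u) △ v ∧ z.2.1 = .nil △ u △ v) ∧
      plane z.1 = j.1 ∧ potential (plane z.2) < potential j.1 := by
  obtain ⟨u, v, hx, hy, h⟩ := exists_pull_of_ne_planeStar j.2
  exact ⟨(⟨_, hx⟩, ⟨_, hy⟩), ⟨u, v, rfl, rfl⟩, h⟩

/-- The rooting `1 1 0 u 0 v` of a plane tree at which its cycle is glued to another one. -/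
noncomputable def source (j : NonStar k) : TreeOfSize k := (exists_gluing_pair j).choose.1

/-- The pulled tree `1 0 1 u 0 v`, whose cycle is the other one taking part in the gluing. -/
noncomputable def target (j : NonStar k) : TreeOfSize k := (exists_gluing_pair j).choose.2

lemma exists_source_target (j : NonStar k) :
    ∃ u v : OrderedTree, (source j).1 = (.nil △ u) △ v ∧ (target j).1 = .nil △ u △ v :=
  (exists_gluing_pair j).choose_spec.1

lemma plane_source (j : NonStar k) : plane (source j) = j.1 :=
  (exists_gluing_pair j).choose_spec.2.1

lemma potential_target_lt (j : NonStar k) : potential (plane (target j)) < potential j.1 :=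
  (exists_gluing_pair j).choose_spec.2.2

lemma source_injective : Function.Injective (source (k := k)) := fun i j h =>
  Subtype.ext (by rw [← plane_source, h, plane_source])

lemma target_injective : Function.Injective (target (k := k)) := by
  intro i j h
  obtain ⟨u, v, h₁, h₂⟩ := exists_source_target i
  obtain ⟨u', v', h₁', h₂'⟩ := exists_source_target j
  rw [h, h₂'] at h₂
  simp only [BinaryTree.node.injEq, true_and] at h₂
  obtain ⟨rfl, rfl⟩ := h₂
  exact source_injective (Subtype.ext (h₁.trans h₁'.symm))

lemma source_ne_target (i j : NonStar k) : source i ≠ target j := by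
  obtain ⟨u, v, h₁, -⟩ := exists_source_target i
  obtain ⟨u', v', -, h₂⟩ := exists_source_target j
  intro h
  rw [Subtype.ext_iff, h₁, h₂] at h
  simp at h

lemma two_le_of_nonStar (j : NonStar k) : 2 ≤ k := by
  obtain ⟨u, v, h, -⟩ := exists_source_target j
  have := (source j).2
  rw [h] at this
  simp only [BinaryTree.numNodes] at this
  omega

variable (σ : NonStar k → Bool)

/-- The position at which a gluing takes place; it may be `0` or `1`, as prescribed by `σ`. -/
def shift (j : NonStar k) : ZMod (2 * k + 1) := if σ j then 1 else 0

lemma shift_eq_zero_or_one (j : NonStar k) : shift σ j = 0 ∨ shift σ j = 1 := by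
  unfold shift
  split_ifs <;> simp

/-- The three edges of the cycle factor on the 6-cycle of a gluing: the edges `0` and `2` lie on
the cycle of the source, the edge `1` lies on the cycle of the target. -/
noncomputable def hexagonEdge : NonStar k × Fin 3 → FactorEdge k
  | (j, 0) => ((source j, shift σ j), true)
  | (j, 1) => ((target j, shift σ j), true)
  | (j, 2) => (step^[3] (source j, shift σ j), false)

lemma hexagonEdge_injective : Function.Injective (hexagonEdge σ) := by
  rintro ⟨i, a⟩ ⟨j, b⟩ h
  fin_cases a <;> fin_cases b <;> simp only [hexagonEdge, Prod.mk.injEq] at h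
  · rw [source_injective h.1.1]
  · exact absurd h.1.1 (source_ne_target i j)
  · simp at h
  · exact absurd h.1.1.symm (source_ne_target j i)
  · rw [target_injective h.1.1]
  · simp at h
  · simp at h
  · simp at h
  · have := congrArg (fun p => plane p.1) h.1
    simp only [plane_step_iterate, plane_source] at this
    rw [Subtype.ext this]

/-- The gluing permutation: it permutes cyclically the three factor edges of each 6-cycle and fixes
all other edges. The lower end of `e` gets joined to the upper end of `gluing σ e`. -/
noncomputable def gluing : Equiv.Perm (FactorEdge k) :=
  Equiv.Perm.viaEmbedding (Equiv.prodCongrRight fun _ => finRotate 3)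
    ⟨hexagonEdge σ, hexagonEdge_injective σ⟩

lemma gluing_hexagonEdge (j : NonStar k) (a : Fin 3) :
    gluing σ (hexagonEdge σ (j, a)) = hexagonEdge σ (j, finRotate 3 a) :=
  Equiv.Perm.viaEmbedding_apply _ ⟨hexagonEdge σ, hexagonEdge_injective σ⟩ (j, a)

lemma gluing_source (j : NonStar k) :
    gluing σ ((source j, shift σ j), true) = ((target j, shift σ j), true) :=
  gluing_hexagonEdge σ j 0

lemma gluing_target (j : NonStar k) :
    gluing σ ((target j, shift σ j), true) = (step^[3] (source j, shift σ j), false) :=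
  gluing_hexagonEdge σ j 1

lemma gluing_step_source (j : NonStar k) :
    gluing σ (step^[3] (source j, shift σ j), false) = ((source j, shift σ j), true) :=
  gluing_hexagonEdge σ j 2

lemma gluing_true_cases (p : Index k) :
    (∃ j, p = (source j, shift σ j)) ∨ (∃ j, p = (target j, shift σ j)) ∨
      gluing σ (p, true) = (p, true) := by
  by_cases h : (p, true) ∈ Set.range (hexagonEdge σ)
  · obtain ⟨⟨j, a⟩, h⟩ := h
    fin_cases a <;> simp only [hexagonEdge, Prod.mk.injEq] at h
    · exact .inl ⟨j, h.1.symm⟩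
    · exact .inr (.inl ⟨j, h.1.symm⟩)
    · simp at h
  · exact .inr (.inr (Equiv.Perm.viaEmbedding_apply_of_notMem _ _ _ h))

lemma gluing_false_cases (p : Index k) :
    (∃ j, p = step^[3] (source j, shift σ j)) ∨ gluing σ (p, false) = (p, false) := by
  by_cases h : (p, false) ∈ Set.range (hexagonEdge σ)
  · obtain ⟨⟨j, a⟩, h⟩ := h
    fin_cases a <;> simp only [hexagonEdge, Prod.mk.injEq] at h
    · simp at h
    · simp at h
    · exact .inl ⟨j, h.1.symm⟩
  · exact .inr (Equiv.Perm.viaEmbedding_apply_of_notMem _ _ _ h)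

/-- The symmetric difference of the cycle factor with the 6-cycles of all gluings. -/
noncomputable def gluedGraph : SimpleGraph (Index k ⊕ Index k) where
  Adj a b := (∃ e : FactorEdge k, a = .inl e.1 ∧ b = .inr (upperEnd (gluing σ e))) ∨
    ∃ e : FactorEdge k, b = .inl e.1 ∧ a = .inr (upperEnd (gluing σ e))
  symm := ⟨fun _ _ h => h.symm⟩
  loopless := ⟨by rintro _ (⟨e, rfl, h⟩ | ⟨e, rfl, h⟩) <;> simp at h⟩

lemma gluedGraph_adj_inl_iff (p : Index k) (b : Index k ⊕ Index k) :
    (gluedGraph σ).Adj (.inl p) b ↔ ∃ c, b = .inr (upperEnd (gluing σ (p, c))) := by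
  constructor
  · rintro (⟨e, h, rfl⟩ | ⟨e, rfl, h⟩)
    · exact ⟨e.2, by rw [Sum.inl.inj h]⟩
    · simp at h
  · rintro ⟨c, rfl⟩
    exact .inl ⟨(p, c), rfl, rfl⟩

lemma gluedGraph_adj_inr_iff (q : Index k) (b : Index k ⊕ Index k) :
    (gluedGraph σ).Adj (.inr q) b ↔ ∃ e, upperEnd e = q ∧ b = .inl ((gluing σ).symm e).1 := by
  constructor
  · rintro (⟨e, h, rfl⟩ | ⟨e, rfl, h⟩)
    · simp at h
    · exact ⟨gluing σ e, (Sum.inr.inj h).symm, by simp⟩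
  · rintro ⟨e, rfl, rfl⟩
    exact .inr ⟨(gluing σ).symm e, rfl, by simp⟩

lemma adj_vertex_of_gluedGraph_adj (hk : 1 ≤ k) {a b : Index k ⊕ Index k}
    (h : (gluedGraph σ).Adj a b) :
    (bipartiteKneserGraph (2 * k + 1) k).Adj (vertex a) (vertex b) := by
  have key (e : FactorEdge k) : (bipartiteKneserGraph (2 * k + 1) k).Adj
      (vertex (.inl e.1)) (vertex (.inr (upperEnd (gluing σ e)))) := by
    obtain ⟨p, _ | _⟩ := e
    · rcases gluing_false_cases σ p with ⟨j, rfl⟩ | h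
      · obtain ⟨u, v, hx, -⟩ := exists_source_target j
        rw [gluing_step_source]
        exact adj_vertex_hexagon₃ _ hx
      · rw [h]
        simpa [upperEnd] using adj_vertex_succ p.1 (p.2 - 1)
    · rcases gluing_true_cases σ p with ⟨j, rfl⟩ | ⟨j, rfl⟩ | h
      · obtain ⟨u, v, hx, hy⟩ := exists_source_target j
        rw [gluing_source]
        exact adj_vertex_hexagon₁ _ hx hy
      · obtain ⟨u, v, hx, hy⟩ := exists_source_target j
        rw [gluing_target]
        simpa [upperEnd, step] using adj_vertex_hexagon₂ (shift σ j) hx hy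
      · rw [h]
        exact adj_vertex_rot p.1 p.2 hk
  rcases h with ⟨e, rfl, rfl⟩ | ⟨e, rfl, rfl⟩
  · exact key e
  · exact (key e).symm

/-! ### The glued graph is 2-regular -/

/-- The two edges at a lower vertex do not coincide: their upper ends have different positions. -/
lemma upperEnd_gluing_ne (hk : 1 ≤ k) (p : Index k) :
    upperEnd (gluing σ (p, true)) ≠ upperEnd (gluing σ (p, false)) := by
  have h1 : (1 : ZMod (2 * k + 1)) ≠ 0 := by
    simpa using natCast_ne_zero (k := k) (m := 1) one_pos (by omega)
  have htrue : (upperEnd (gluing σ (p, true))).2 = p.2 ∨ ∃ j : NonStar k, p.2 = shift σ j ∧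
      (upperEnd (gluing σ (p, true))).2 = p.2 + 2 := by
    rcases gluing_true_cases σ p with ⟨j, rfl⟩ | ⟨j, rfl⟩ | h
    · rw [gluing_source]
      exact .inl rfl
    · rw [gluing_target, step_iterate]
      refine .inr ⟨j, rfl, ?_⟩
      simp only [upperEnd]
      push_cast
      ring
    · rw [h]
      exact .inl rfl
  have hfalse : (upperEnd (gluing σ (p, false))).2 = p.2 - 1 ∨ ∃ j : NonStar k,
      p.2 = shift σ j + 3 ∧ (upperEnd (gluing σ (p, false))).2 = p.2 - 3 := by
    rcases gluing_false_cases σ p with ⟨j, rfl⟩ | h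
    · rw [gluing_step_source, step_iterate]
      refine .inr ⟨j, by push_cast; rfl, ?_⟩
      simp only [upperEnd]
      push_cast
      ring
    · rw [h]
      exact .inl rfl
  have h3 (j : NonStar k) : (3 : ZMod (2 * k + 1)) ≠ 0 := by
    have := two_le_of_nonStar j
    simpa using natCast_ne_zero (k := k) (m := 3) (by omega) (by omega)
  intro h
  have h := congrArg Prod.snd h
  rcases htrue with ht | ⟨i, hi, ht⟩ <;> rcases hfalse with hf | ⟨j, hj, hf⟩ <;>
    rw [ht, hf] at h
  · exact h1 (by linear_combination h)
  · exact h3 j (by linear_combination h)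
  · exact h3 i (by linear_combination h)
  -- Here the positions of two gluings would differ by 3, but they are both 0 or 1.
  · have h2 : (2 : ZMod (2 * k + 1)) ≠ 0 := by
      have := two_le_of_nonStar j
      simpa using natCast_ne_zero (k := k) (m := 2) (by omega) (by omega)
    have h4 : (4 : ZMod (2 * k + 1)) ≠ 0 := by
      have := two_le_of_nonStar j
      simpa using natCast_ne_zero (k := k) (m := 4) (by omega) (by omega)
    rw [hi] at hj
    rcases shift_eq_zero_or_one σ i with hi | hi <;>
      rcases shift_eq_zero_or_one σ j with hj' | hj' <;>
      rw [hi, hj'] at hj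
    · exact h3 j (by linear_combination -hj)
    · exact h4 (by linear_combination -hj)
    · exact h2 (by linear_combination -hj)
    · exact h3 j (by linear_combination -hj)

lemma ncard_neighborSet_gluedGraph (hk : 1 ≤ k) (a : Index k ⊕ Index k) :
    ((gluedGraph σ).neighborSet a).ncard = 2 := by
  rcases a with p | q
  · have : (gluedGraph σ).neighborSet (.inl p) = {.inr (upperEnd (gluing σ (p, true))),
        .inr (upperEnd (gluing σ (p, false)))} := by
      ext b
      rw [SimpleGraph.mem_neighborSet, gluedGraph_adj_inl_iff, Bool.exists_bool, or_comm]
      rfl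
    rw [this, Set.ncard_pair fun h => upperEnd_gluing_ne σ hk p (Sum.inr.inj h)]
  · set e : FactorEdge k := ((rot.symm q.1, q.2), true)
    set e' : FactorEdge k := ((q.1, q.2 + 1), false)
    have he : upperEnd e = q := (upperEnd_eq_iff e q).2 (.inl rfl)
    have he' : upperEnd e' = q := (upperEnd_eq_iff e' q).2 (.inr rfl)
    have : (gluedGraph σ).neighborSet (.inr q) =
        {.inl ((gluing σ).symm e).1, .inl ((gluing σ).symm e').1} := by
      ext b
      rw [SimpleGraph.mem_neighborSet, gluedGraph_adj_inr_iff]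
      simp only [upperEnd_eq_iff, or_and_right, exists_or, exists_eq_left]
      rfl
    rw [this, Set.ncard_pair]
    intro h
    replace h := Sum.inl.inj h
    obtain ⟨⟨p, c⟩, hc⟩ := (gluing σ).surjective e
    obtain ⟨⟨p', c'⟩, hc'⟩ := (gluing σ).surjective e'
    rw [← hc, ← hc', Equiv.symm_apply_apply, Equiv.symm_apply_apply] at h
    obtain rfl : p = p' := h
    have key := upperEnd_gluing_ne σ hk p
    rw [← hc] at he
    rw [← hc'] at he'
    cases c <;> cases c'
    · exact absurd (congrArg Prod.snd (hc.symm.trans hc')) (by simp [e, e'])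
    · exact key (he'.trans he.symm)
    · exact key (he.trans he'.symm)
    · exact absurd (congrArg Prod.snd (hc.symm.trans hc')) (by simp [e, e'])

/-! ### The glued graph is connected -/

lemma reachable_upperEnd_gluing (e : FactorEdge k) :
    (gluedGraph σ).Reachable (.inl e.1) (.inr (upperEnd (gluing σ e))) :=
  SimpleGraph.Adj.reachable (.inl ⟨e, rfl, rfl⟩)

/-- If the edges removed from the cycle of `j` by the gluings into that cycle have connected ends,
then so has the edge that the gluing of `j` removes from the target cycle. Indeed, deleting the
edges `0` and `2` of the 6-cycle splits the cycle of `j` into two connected paths, and the three new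
edges attach them to both ends of the edge `1`. The second part concerns the longer path. -/
lemma reachable_target_of_reachable (j : NonStar k)
    (hj : ∀ i : NonStar k, plane (target i) = j.1 → (gluedGraph σ).Reachable
      (.inl (target i, shift σ i)) (.inr (upperEnd ((target i, shift σ i), true)))) :
    (gluedGraph σ).Reachable
        (.inl (target j, shift σ j)) (.inr (upperEnd ((target j, shift σ j), true))) ∧
      (gluedGraph σ).Reachable
        (.inl (step^[3] (source j, shift σ j))) (.inl (source j, shift σ j)) := by
  set p₀ : Index k := (source j, shift σ j) with hp₀
  set p : ℕ → Index k := fun m => step^[m] p₀ with hp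
  have hplane (m : ℕ) : plane (p m).1 = j.1 := (plane_step_iterate m p₀).trans (plane_source j)
  have hsucc (m : ℕ) : step (p m) = p (m + 1) := (Function.iterate_succ_apply' step m p₀).symm
  have hout (m : ℕ) (hm : p m ≠ p₀) :
      (gluedGraph σ).Reachable (.inl (p m)) (.inr (upperEnd (p m, true))) := by
    rcases gluing_true_cases σ (p m) with ⟨i, hi⟩ | ⟨i, hi⟩ | h
    · have hij : i = j := Subtype.ext (by rw [← plane_source, ← hplane m, hi])
      exact absurd (hi.trans (by rw [hij])) hm
    · rw [hi]
      exact hj i (by rw [← hplane m, hi])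
    · have := reachable_upperEnd_gluing σ (p m, true)
      rwa [h] at this
  have hin (m : ℕ) (hm : p m ≠ p 3) :
      (gluedGraph σ).Reachable (.inl (p m)) (.inr (upperEnd (p m, false))) := by
    rcases gluing_false_cases σ (p m) with ⟨i, hi⟩ | h
    · have hij : i = j := Subtype.ext (by
        rw [← plane_source, ← hplane m, hi, plane_step_iterate])
      exact absurd (hi.trans (by rw [hij])) hm
    · have := reachable_upperEnd_gluing σ (p m, false)
      rwa [h] at this
  have hnext (m : ℕ) (h₀ : p m ≠ p₀) (h₃ : p (m + 1) ≠ p 3) :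
      (gluedGraph σ).Reachable (.inl (p m)) (.inl (p (m + 1))) := by
    have := hin (m + 1) h₃
    rw [← hsucc, upperEnd_step] at this
    rw [← hsucc]
    exact (hout m h₀).trans this.symm
  -- `L` is the number of lower vertices on the cycle.
  set L := Function.minimalPeriod step p₀ with hL
  have hk := two_le_of_nonStar j
  have hper : p L = p₀ := Function.iterate_minimalPeriod
  have hLdvd : 2 * k + 1 ∣ L := by
    rw [← ZMod.natCast_eq_zero_iff]
    have := congrArg Prod.snd hper
    simpa [hp, step_iterate] using this
  have hLpos : 0 < L := by
    refine Function.minimalPeriod_pos_of_mem_periodicPts ⟨2 * k * (2 * k + 1), by positivity, ?_⟩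
    rw [Function.IsPeriodicPt, Function.IsFixedPt, step_iterate]
    refine Prod.ext (Subtype.ext ?_) ?_
    · rw [coe_rot_iterate, Function.iterate_mul]
      have := rotate_iterate_self p₀.1.1
      rw [p₀.1.2] at this
      exact Function.iterate_fixed this _
    · simp
  have hL5 : 5 ≤ L := le_trans (by omega) (Nat.le_of_dvd hLpos hLdvd)
  have hinj (a b : ℕ) (ha : a < L) (hb : b < L) (hab : a ≠ b) : p a ≠ p b := fun h =>
    hab (Function.iterate_injOn_Iio_minimalPeriod (f := step) (x := p₀) ha hb h)
  have hlong (m : ℕ) (h3 : 3 ≤ m) (hm : m ≤ L) :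
      (gluedGraph σ).Reachable (.inl (p 3)) (.inl (p m)) := by
    induction m, h3 using Nat.le_induction with
    | base => exact .refl _
    | succ m h3 ih =>
      refine (ih (by omega)).trans (hnext m (hinj m 0 (by omega) (by omega) (by omega)) ?_)
      rcases hm.lt_or_eq with hm | hm
      · exact hinj _ 3 hm (by omega) (by omega)
      · rw [hm, hper]
        exact hinj 0 3 (by omega) (by omega) (by omega)
  have h1 := reachable_upperEnd_gluing σ ((target j, shift σ j), true)
  have h2 := reachable_upperEnd_gluing σ (p 3, false)
  have h3 := reachable_upperEnd_gluing σ (p₀, true)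
  rw [gluing_target] at h1
  rw [gluing_step_source] at h2
  rw [gluing_source] at h3
  have h4 := hin 1 (hinj 1 3 (by omega) (by omega) (by omega))
  have h5 := hnext 1 (hinj 1 0 (by omega) (by omega) (by omega))
    (hinj 2 3 (by omega) (by omega) (by omega))
  have h6 := hout 2 (hinj 2 0 (by omega) (by omega) (by omega))
  have h7 := hlong L (by omega) le_rfl
  rw [hper] at h7
  rw [← upperEnd_step, hsucc] at h6
  rw [← hsucc 0, upperEnd_step] at h4
  exact ⟨h1.trans (h6.symm.trans (h5.symm.trans (h4.trans (h2.symm.trans (h7.trans h3))))), h7⟩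

lemma reachable_target (j : NonStar k) :
    (gluedGraph σ).Reachable
        (.inl (target j, shift σ j)) (.inr (upperEnd ((target j, shift σ j), true))) ∧
      (gluedGraph σ).Reachable
        (.inl (step^[3] (source j, shift σ j))) (.inl (source j, shift σ j)) := by
  obtain ⟨B, hB⟩ := (Set.finite_range (potential (n := k))).bddAbove
  have hB' (q : PlaneTree k) : potential q ≤ B := hB ⟨q, rfl⟩
  induction h : B - potential j.1 using Nat.strong_induction_on generalizing j with
  | _ m ih =>
    refine reachable_target_of_reachable σ j fun i hi => (ih _ ?_ i rfl).1
    have := potential_target_lt i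
    rw [hi] at this
    have := hB' i.1
    omega

/-- The gluings keep the ends of every edge of the cycle factor connected. -/
lemma reachable_upperEnd (e : FactorEdge k) :
    (gluedGraph σ).Reachable (.inl e.1) (.inr (upperEnd e)) := by
  have he := reachable_upperEnd_gluing σ e
  have h₀ (j : NonStar k) := reachable_upperEnd_gluing σ ((source j, shift σ j), true)
  have h₁ (j : NonStar k) := reachable_upperEnd_gluing σ ((target j, shift σ j), true)
  have h₂ (j : NonStar k) :=
    reachable_upperEnd_gluing σ (step^[3] (source j, shift σ j), false)
  simp only [gluing_source, gluing_target, gluing_step_source] at h₀ h₁ h₂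
  obtain ⟨p, _ | _⟩ := e
  · rcases gluing_false_cases σ p with ⟨j, rfl⟩ | h
    · obtain ⟨ht, hs⟩ := reachable_target σ j
      exact hs.trans ((h₀ j).trans (ht.symm.trans (h₁ j)))
    · rwa [h] at he
  · rcases gluing_true_cases σ p with ⟨j, rfl⟩ | ⟨j, rfl⟩ | h
    · exact (reachable_target σ j).2.symm.trans (h₂ j)
    · exact (reachable_target σ j).1
    · rwa [h] at he

lemma reachable_step_iterate (p : Index k) (m : ℕ) :
    (gluedGraph σ).Reachable (.inl p) (.inl (step^[m] p)) := by
  induction m with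
  | zero => exact .refl _
  | succ m h =>
    rw [Function.iterate_succ_apply']
    have := reachable_upperEnd σ (step (step^[m] p), false)
    rw [upperEnd_step] at this
    exact h.trans ((reachable_upperEnd σ (step^[m] p, true)).trans this.symm)

lemma reachable_same_tree (t : TreeOfSize k) (s s' : ZMod (2 * k + 1)) :
    (gluedGraph σ).Reachable (.inl (t, s)) (.inl (t, s')) := by
  have key (m : ℕ) : (gluedGraph σ).Reachable (.inl (t, s)) (.inl (t, s - m)) := by
    induction m with
    | zero => simp
    | succ m h =>
      have := reachable_step_iterate σ (t, s - m) (2 * k)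
      rw [step_iterate_two_mul] at this
      rw [Nat.cast_succ, ← sub_sub]
      exact h.trans this
  simpa using key (s - s').val

lemma reachable_of_plane_eq {t t' : TreeOfSize k} (h : plane t = plane t')
    (s s' : ZMod (2 * k + 1)) : (gluedGraph σ).Reachable (.inl (t, s)) (.inl (t', s')) := by
  obtain ⟨m, hm⟩ := plane_eq_iff.1 h
  have := reachable_step_iterate σ (t, s) m
  rw [step_iterate, show rot^[m] t = t' from Subtype.ext ((coe_rot_iterate m t).trans hm)] at this
  exact this.trans (reachable_same_tree σ _ _ _)

lemma reachable_star (p : Index k) :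
    (gluedGraph σ).Reachable (.inl p) (.inl (⟨star k, numNodes_star k⟩, 0)) := by
  induction h : potential (plane p.1) using Nat.strong_induction_on generalizing p with
  | _ m ih =>
    by_cases hp : plane p.1 = planeStar k
    · exact reachable_of_plane_eq σ hp _ _
    · let j : NonStar k := ⟨plane p.1, hp⟩
      have h₁ := reachable_of_plane_eq σ (plane_source j).symm p.2 (shift σ j)
      have h₂ := reachable_upperEnd_gluing σ ((source j, shift σ j), true)
      rw [gluing_source] at h₂
      exact h₁.trans (h₂.trans ((reachable_target σ j).1.symm.trans
        (ih _ (h ▸ potential_target_lt j) _ rfl)))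

lemma connected_gluedGraph : (gluedGraph σ).Connected := by
  have key (a : Index k ⊕ Index k) :
      (gluedGraph σ).Reachable a (.inl (⟨star k, numNodes_star k⟩, 0)) := by
    rcases a with p | q
    · exact reachable_star σ p
    · have := reachable_upperEnd σ ((q.1, q.2 + 1), false)
      rw [(upperEnd_eq_iff _ q).2 (.inr rfl)] at this
      exact this.symm.trans (reachable_star σ _)
  exact { preconnected := fun a b => (key a).trans (key b).symm
          nonempty := ⟨.inl (⟨star k, numNodes_star k⟩, 0)⟩ }

/-! ### Hamilton cycles -/

/-- A connected 2-regular finite graph is a Hamilton cycle. -/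
lemma exists_isHamiltonianCycle_of_connected {V : Type*} [Finite V] [DecidableEq V]
    {H : SimpleGraph V} (hc : H.Connected) (h2 : ∀ v, (H.neighborSet v).ncard = 2) :
    ∃ (v : V) (p : H.Walk v v), p.IsHamiltonianCycle ∧ ∀ a b, p.toSubgraph.Adj a b ↔ H.Adj a b := by
  obtain ⟨v⟩ := hc.nonempty
  have hcyc : H.IsCycles := fun w _ => h2 w
  obtain ⟨p, hp, hverts⟩ := hcyc.exists_cycle_toSubgraph_verts_eq_connectedComponentSupp
    (c := H.connectedComponentMk v) rfl (Set.nonempty_of_ncard_ne_zero (by rw [h2]; norm_num))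
  have hmem (w : V) : w ∈ p.support := by
    rw [← SimpleGraph.Walk.mem_verts_toSubgraph, hverts]
    exact SimpleGraph.ConnectedComponent.sound (hc.preconnected w v)
  refine ⟨v, p, ⟨hp, hp.isPath_tail.isHamiltonian_of_mem fun w => ?_⟩, fun a b => ?_⟩
  · rw [SimpleGraph.Walk.support_tail_of_not_nil _ hp.not_nil]
    rcases List.mem_cons.1 (p.cons_tail_support.symm ▸ hmem w) with rfl | h
    · exact p.end_mem_tail_support hp.not_nil
    · exact h
  · have : H.LocallyFinite := fun w => Fintype.ofFinite _
    exact hp.adj_toSubgraph_iff_of_isCycles hcyc (by simpa using hmem a) b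

lemma exists_mem_hamiltonCycles (hk : 1 ≤ k) :
    ∃ C ∈ hamiltonCycles (bipartiteKneserGraph (2 * k + 1) k),
      ∀ a b, C.Adj (vertex a) (vertex b) ↔ (gluedGraph σ).Adj a b := by
  classical
  obtain ⟨v, p, hp, hadj⟩ := exists_isHamiltonianCycle_of_connected (connected_gluedGraph σ)
    (ncard_neighborSet_gluedGraph σ hk)
  let f : gluedGraph σ →g bipartiteKneserGraph (2 * k + 1) k :=
    ⟨vertex, adj_vertex_of_gluedGraph_adj σ hk⟩
  refine ⟨(p.map f).toSubgraph, ⟨_, p.map f, ?_, rfl⟩, fun a b => ?_⟩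
  · exact hp.map (f := f) vertex_bijective
  · rw [SimpleGraph.Walk.toSubgraph_map, ← hadj, SimpleGraph.Subgraph.map_adj]
    exact Relation.map_apply_apply vertex_injective vertex_injective _ _ _

/-- The position of every gluing can be read off from the glued graph: only the gluing of `j` at
position `shift σ j` creates the edge from `(source j, shift σ j)` to
`(rot (target j), shift σ j)`. -/
lemma gluedGraph_injective : Function.Injective (gluedGraph (k := k)) := by
  intro σ τ h
  by_contra hne
  obtain ⟨j, hj⟩ := Function.ne_iff.1 hne
  have hk := two_le_of_nonStar j
  have h1 : (1 : ZMod (2 * k + 1)) ≠ 0 := by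
    simpa using natCast_ne_zero (k := k) (m := 1) one_pos (by omega)
  have h3 : (3 : ZMod (2 * k + 1)) ≠ 0 := by
    simpa using natCast_ne_zero (k := k) (m := 3) (by omega) (by omega)
  have hshift : shift σ j ≠ shift τ j := by
    unfold shift
    cases hs : σ j <;> cases ht : τ j
    · exact absurd (hs.trans ht.symm) hj
    · simpa using h1.symm
    · simpa using h1
    · exact absurd (hs.trans ht.symm) hj
  have hadj : (gluedGraph σ).Adj (.inl (source j, shift σ j))
      (.inr (upperEnd ((target j, shift σ j), true))) := by
    rw [gluedGraph_adj_inl_iff]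
    exact ⟨true, by rw [gluing_source]⟩
  rw [h, gluedGraph_adj_inl_iff] at hadj
  obtain ⟨_ | _, hc⟩ := hadj <;> replace hc := Sum.inr.inj hc
  · have hc := congrArg Prod.snd hc
    rcases gluing_false_cases τ (source j, shift σ j) with ⟨i, hi⟩ | hi
    · rw [hi, gluing_step_source] at hc
      rw [step_iterate] at hi
      have hi := congrArg Prod.snd hi
      simp only [upperEnd] at hc hi
      push_cast at hi
      exact h3 (by linear_combination hc - hi)
    · rw [hi] at hc
      simp only [upperEnd] at hc
      exact h1 (by linear_combination hc)
  · rcases gluing_true_cases τ (source j, shift σ j) with ⟨i, hi⟩ | ⟨i, hi⟩ | hi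
    · rw [Prod.mk.injEq] at hi
      obtain rfl := source_injective hi.1
      exact hshift hi.2
    · rw [Prod.mk.injEq] at hi
      exact source_ne_target j i hi.1
    · rw [hi] at hc
      exact source_ne_target j j (rot.injective (congrArg Prod.fst hc)).symm

lemma two_pow_card_nonStar_le (hk : 1 ≤ k) : 2 ^ Nat.card (NonStar k) ≤
    (hamiltonCycles (bipartiteKneserGraph (2 * k + 1) k)).ncard := by
  choose C hC hadj using fun σ : NonStar k → Bool => exists_mem_hamiltonCycles σ hk
  have hinj : Function.Injective C := fun σ τ h => gluedGraph_injective <| by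
    ext a b
    rw [← hadj, ← hadj, h]
  calc 2 ^ Nat.card (NonStar k) = Nat.card (NonStar k → Bool) := by simp [Nat.card_fun]
    _ = (Set.range C).ncard := by
      rw [← Set.image_univ, Set.ncard_image_of_injective _ hinj, Set.ncard_univ]
    _ ≤ _ := Set.ncard_le_ncard (Set.range_subset_iff.2 hC) (Set.toFinite _)

lemma card_nonStar_add_one (k : ℕ) : Nat.card (NonStar k) + 1 = Nat.card (PlaneTree k) := by
  classical
  rw [Nat.card_eq_fintype_card, Nat.card_eq_fintype_card, Fintype.card_subtype_compl,
    Fintype.card_subtype_eq]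
  exact Nat.sub_add_cancel (Fintype.card_pos_iff.2 ⟨planeStar k⟩)

end MiddleLevels

theorem mainTheorem4 :
    (∀ k : ℕ, 1 ≤ k → (hamiltonCycles (bipartiteKneserGraph (2 * k + 1) k)).Nonempty) ∧
    (∀ k : ℕ, 6 ≤ k →
      2 ^ (2 ^ (k - 6)) ≤ (hamiltonCycles (bipartiteKneserGraph (2 * k + 1) k)).ncard) := by
  refine ⟨fun k hk => ?_, fun k hk => ?_⟩
  · obtain ⟨C, hC, -⟩ := MiddleLevels.exists_mem_hamiltonCycles (fun _ => false) hk
    exact ⟨C, hC⟩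
  · refine le_trans (Nat.pow_le_pow_right two_pos ?_)
      (MiddleLevels.two_pow_card_nonStar_le (by omega))
    have h₁ := MiddleLevels.two_pow_lt_card_planeTree hk
    have h₂ := MiddleLevels.card_nonStar_add_one k
    omega
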